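/- Throughout, rings are not assumed to be associative, commutative or unital. For elements of a ring write $(x,y,z)=(xy)z-x(yz)$ and $[x,y]=xy-yx$. A ring $R$ is alternative if $(x,x,y)=0=(y,x,x)$ for all $x,y\in R$; it is $3$-torsion free if $3x=0$ implies $x=0$ for all $x\in R$; it is prime if $AB\neq 0$ for any two nonzero (two-sided) ideals $A,B$ of $R$. A nontrivial idempotent of $R$ is a nonzero element $e\in R$ with $ee=e$ that is not a multiplicative identity element of $R$. The centre $\mathcal{Z}(R)$ is the set of all $z\in R$ with $[z,x]=0$ and $(z,x,y)=(x,z,y)=(x,y,z)=0$ for all $x,y\in R$. Corollary. Let $R$ be a $3$-torsion free prime alternative ring containing a nontrivial idempotent. Let $D\colon R\to R$ be a Lie triple derivable multiplicative map, that is, a map (not assumed additive) such that $$D\big([[x,y],z]\big)=[[D(x),y],z]+[[x,D(y)],z]+[[x,y],D(z)]\quad\text{for all }x,y,z\in R.$$ Then $D$ is almost additive: for all $a,b\in R$ there exists $z_{a,b}\in\mathcal{Z}(R)$ such that $D(a+b)=D(a)+D(b)+z_{a,b}$. -/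

import Mathlib

namespace AltRing

/-- A (not necessarily associative, unital or commutative) ring is alternative if the associator
satisfies `(x, x, y) = 0 = (y, x, x)`. -/
def IsAlternative (R : Type*) [NonUnitalNonAssocRing R] : Prop :=
  ∀ x y : R, associator x x y = 0 ∧ associator y x x = 0

/-- `R` is `k`-torsion free if `k x = 0` implies `x = 0`. -/
def IsTorsionFreeBy (k : ℕ) (R : Type*) [NonUnitalNonAssocRing R] : Prop :=
  ∀ x : R, k • x = 0 → x = 0

/-- `R` is prime if `A B ≠ 0` for any two nonzero (two-sided) ideals `A`, `B`;
the product `A B` is nonzero iff some product `a * b` with `a ∈ A`, `b ∈ B` is nonzero. -/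
def IsPrimeRing (R : Type*) [NonUnitalNonAssocRing R] : Prop :=
  ∀ A B : TwoSidedIdeal R, A ≠ ⊥ → B ≠ ⊥ → ∃ a ∈ A, ∃ b ∈ B, a * b ≠ 0

/-- A nontrivial idempotent: a nonzero element `e` with `e * e = e` which is not a multiplicative
identity element of `R` (the ring `R` need not have one). -/
def IsNontrivialIdempotent {R : Type*} [NonUnitalNonAssocRing R] (e : R) : Prop :=
  e ≠ 0 ∧ IsIdempotentElem e ∧ ¬ ∀ x : R, e * x = x ∧ x * e = x

/-- A Lie triple derivable multiplicative map; `⁅x, y⁆ = x * y - y * x`. No additivity is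
required of `D`. -/
def IsLieTripleDerivable {R : Type*} [NonUnitalNonAssocRing R] (D : R → R) : Prop :=
  ∀ x y z : R, D ⁅⁅x, y⁆, z⁆ = ⁅⁅D x, y⁆, z⁆ + ⁅⁅x, D y⁆, z⁆ + ⁅⁅x, y⁆, D z⁆

/-- A map `D` is almost additive if it is additive up to central elements. Mathlib's `Set.center`
of a nonassociative ring consists of the elements that commute with all elements and lie in the
nucleus. -/
def IsAlmostAdditive {R : Type*} [NonUnitalNonAssocRing R] (D : R → R) : Prop :=
  ∀ a b : R, ∃ z ∈ Set.center R, D (a + b) = D a + D b + z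

end AltRing

/-!
The additivity defect `δ(a, b) = D (a + b) - D a - D b` forgets the derivation part of the identity
for `D`: it satisfies `[[δ(a, b), y], z] = δ([[a, y], z], [[b, y], z])` and
`[[x, y], δ(a, b)] = δ([[x, y], a], [[x, y], b])`, and `δ(a, 0) = 0`. The theorem says that all
defects are central.

Decompose `R = R_11 + R_12 + R_21 + R_22` with respect to the idempotent `e`. The map `[[·, e], e]`
kills the diagonal part `R_11 + R_22` and fixes `R_12 + R_21`, so `δ(a, b)` is diagonal whenever `a`
or `b` is (`IsLieTripleDerivable.commute_defect`).

The ring-theoretic input is that a diagonal element `f` commuting with `R_ij`, for one pair `i ≠ j`,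
is central (`IsPrimeRing.lie_eq_zero_of_offdiag` and `IsAlternative.mem_center`). It rests on two
faithfulness statements for prime alternative rings, `IsPrimeRing.eq_zero_of_offdiag_mul` and
`IsPrimeRing.eq_zero_of_offdiag`, each proved by exhibiting the offending elements inside an ideal
whose left annihilator, which is again an ideal, is too large. Torsion-freeness enters only to pass
from commuting with everything to being central, through
`[x y, z] = x [y, z] + [x, z] y + 3 (x, y, z)`.

If `f = δ(a, b)` is diagonal and `y ∈ R_ij`, then `[y, f] = δ([y, a], [y, b])` lies in `R_ij`; when
the right-hand side is diagonal for all such `y`, the defect `f` is central. This gives the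
centrality of `δ(a, b)` for `a` diagonal and `b ∈ R_ij`. In particular `δ(e, b)` is central, and
expanding `[[e + a, e - b], e]` and `[[e - a, -e - b], e]` shows that `D` is additive on
`R_12 + R_21` and on each `R_ij`. The remaining defects, between two diagonal elements and between
the diagonal and off-diagonal parts of an element, follow by the same criterion.
-/

namespace AltRing

variable {R : Type*} [NonUnitalNonAssocRing R] {e : R} {D : R → R}

/-! ### Associators in alternative rings -/

theorem IsAlternative.associator_swap_left (halt : IsAlternative R) (x y z : R) :
    associator x y z = -associator y x z := by
  have h := (halt (x + y) z).1
  have hx := (halt x z).1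
  have hy := (halt y z).1
  simp only [associator, add_mul, mul_add] at h hx hy ⊢
  rw [← sub_eq_zero]
  have : x * y * z - x * (y * z) - -(y * x * z - y * (x * z)) =
      (x * x * z + y * x * z + (x * y * z + y * y * z) -
        (x * (x * z) + y * (x * z) + (x * (y * z) + y * (y * z))))
      - (x * x * z - x * (x * z)) - (y * y * z - y * (y * z)) := by abel
  rw [this, hx, hy, h, sub_zero, sub_zero]

theorem IsAlternative.associator_swap_right (halt : IsAlternative R) (x y z : R) :
    associator x y z = -associator x z y := by
  have h := (halt (y + z) x).2
  have hy := (halt y x).2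
  have hz := (halt z x).2
  simp only [associator, add_mul, mul_add] at h hy hz ⊢
  rw [← sub_eq_zero]
  have : x * y * z - x * (y * z) - -(x * z * y - x * (z * y)) =
      (x * y * y + x * z * y + (x * y * z + x * z * z) -
        (x * (y * y) + x * (z * y) + (x * (y * z) + x * (z * z))))
      - (x * y * y - x * (y * y)) - (x * z * z - x * (z * z)) := by abel
  rw [this, hy, hz, h, sub_zero, sub_zero]

theorem IsAlternative.associator_rotate (halt : IsAlternative R) (x y z : R) :
    associator x y z = associator y z x := by
  rw [halt.associator_swap_left, halt.associator_swap_right, neg_neg]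

theorem mul_assoc_of_associator_eq_zero {x y z : R} (h : associator x y z = 0) :
    x * y * z = x * (y * z) := sub_eq_zero.1 h

theorem IsAlternative.mul_mul_self (halt : IsAlternative R) (x y : R) :
    y * x * x = y * (x * x) := sub_eq_zero.1 (halt x y).2

theorem IsAlternative.self_mul_mul (halt : IsAlternative R) (x y : R) :
    x * (x * y) = x * x * y := (sub_eq_zero.1 (halt x y).1).symm

theorem IsAlternative.flexible (halt : IsAlternative R) (x y : R) :
    x * y * x = x * (y * x) := by
  apply sub_eq_zero.1
  have := halt.associator_swap_left x y x
  rw [(halt x y).2, neg_zero] at this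
  exact this

theorem IsAlternative.lie_mul (halt : IsAlternative R) (x y z : R) :
    ⁅x * y, z⁆ = x * ⁅y, z⁆ + ⁅x, z⁆ * y + 3 • associator x y z := by
  have h : (3 : ℕ) • associator x y z
      = associator x y z - associator x z y + associator z x y := by
    rw [halt.associator_rotate z x y, halt.associator_swap_right x z y]
    abel
  rw [h]
  simp only [associator, Ring.lie_def, mul_sub, sub_mul]
  abel

/-- In a `3`-torsion free alternative ring, an element that commutes with everything also lies in
the nucleus: its associators vanish because `[x y, z] = x [y, z] + [x, z] y + 3 (x, y, z)`. -/
theorem IsAlternative.mem_center (halt : IsAlternative R) (htf : IsTorsionFreeBy 3 R) {z : R}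
    (hz : ∀ x : R, ⁅x, z⁆ = 0) : z ∈ Set.center R := by
  have h (x y : R) : associator x y z = 0 := by
    apply htf
    have := halt.lie_mul x y z
    simpa [hz] using this.symm
  refine ⟨fun x => (sub_eq_zero.1 (hz x)).symm, fun x y => ?_, fun x y => ?_⟩
  · have := h x y
    rw [← halt.associator_rotate z x y] at this
    exact (mul_assoc_of_associator_eq_zero this).symm
  · exact mul_assoc_of_associator_eq_zero (h x y)

/-! ### Ideals and annihilators in prime rings -/

/-- A prime ring has no two nonzero ideals with product zero; ideals are given here as additive
subgroups closed under multiplication by arbitrary elements. -/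
theorem IsPrimeRing.eq_bot_or_eq_bot (hprime : IsPrimeRing R) (A B : AddSubgroup R)
    (hA : ∀ r, ∀ a ∈ A, r * a ∈ A ∧ a * r ∈ A) (hB : ∀ r, ∀ b ∈ B, r * b ∈ B ∧ b * r ∈ B)
    (h : ∀ a ∈ A, ∀ b ∈ B, a * b = 0) : (∀ a ∈ A, a = 0) ∨ ∀ b ∈ B, b = 0 := by
  have key (A : AddSubgroup R) (hA : ∀ r, ∀ a ∈ A, r * a ∈ A ∧ a * r ∈ A) :
      ∃ I : TwoSidedIdeal R, ∀ x, x ∈ I ↔ x ∈ A :=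
    ⟨.mk' A A.zero_mem A.add_mem A.neg_mem (fun h => (hA _ _ h).1) (fun h => (hA _ _ h).2),
      fun x => TwoSidedIdeal.mem_mk' ..⟩
  obtain ⟨I, hI⟩ := key A hA
  obtain ⟨J, hJ⟩ := key B hB
  by_contra! hne
  obtain ⟨⟨a, ha, ha0⟩, b, hb, hb0⟩ := hne
  obtain ⟨x, hx, y, hy, hxy⟩ := hprime I J
    (fun h0 => ha0 ((TwoSidedIdeal.mem_bot R).1 (h0 ▸ (hI a).2 ha)))
    (fun h0 => hb0 ((TwoSidedIdeal.mem_bot R).1 (h0 ▸ (hJ b).2 hb)))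
  exact hxy (h x ((hI x).1 hx) y ((hJ y).1 hy))

/-- The left annihilator of an ideal of an alternative ring is an ideal. Hence in a prime
alternative ring a nonzero ideal has zero left annihilator. -/
theorem IsPrimeRing.eq_zero_of_mul_ideal (hprime : IsPrimeRing R) (halt : IsAlternative R)
    (K : AddSubgroup R) (hK : ∀ r, ∀ a ∈ K, r * a ∈ K ∧ a * r ∈ K) {k : R} (hk : k ∈ K)
    (hk0 : k ≠ 0) {m : R} (hm : ∀ a ∈ K, m * a = 0) : m = 0 := by
  let A : AddSubgroup R :=
    { carrier := {m | ∀ a ∈ K, m * a = 0}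
      zero_mem' := by simp
      add_mem' := fun hx hy a ha => by rw [add_mul, hx a ha, hy a ha, add_zero]
      neg_mem' := fun hx a ha => by rw [neg_mul, hx a ha, neg_zero] }
  have hA : ∀ r, ∀ x ∈ A, r * x ∈ A ∧ x * r ∈ A := by
    intro r x hx
    have h0 (a) (ha : a ∈ K) : associator r x a = 0 := by
      rw [halt.associator_rotate, associator, hx a ha, hx _ (hK r a ha).2, zero_mul, sub_zero]
    refine ⟨fun a ha => ?_, fun a ha => ?_⟩
    · rw [mul_assoc_of_associator_eq_zero (h0 a ha), hx a ha, mul_zero]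
    · have : associator x r a = 0 := by rw [halt.associator_swap_left, h0 a ha, neg_zero]
      rw [mul_assoc_of_associator_eq_zero this, hx _ (hK r a ha).1]
  rcases hprime.eq_bot_or_eq_bot A K hA hK (fun a ha b hb => ha b hb) with h | h
  · exact h m hm
  · exact absurd (h k hk) hk0

theorem IsAlternative.op (halt : IsAlternative R) : IsAlternative Rᵐᵒᵖ := fun x y => by
  simp [halt x.unop y.unop]

theorem IsPrimeRing.op (hprime : IsPrimeRing R) : IsPrimeRing Rᵐᵒᵖ := by
  intro A B hA hB
  have hne {A : TwoSidedIdeal Rᵐᵒᵖ} (hA : A ≠ ⊥) : A.unop ≠ ⊥ := fun h =>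
    hA (TwoSidedIdeal.opOrderIso.symm.injective (h.trans TwoSidedIdeal.opOrderIso.symm.map_bot.symm))
  obtain ⟨b, hb, a, ha, h⟩ := hprime B.unop A.unop (hne hB) (hne hA)
  refine ⟨.op a, TwoSidedIdeal.mem_unop_iff.1 ha, .op b, TwoSidedIdeal.mem_unop_iff.1 hb, ?_⟩
  rwa [← MulOpposite.op_mul, MulOpposite.op_ne_zero_iff]

/-! ### Peirce components -/

/-- The Peirce component `R_ij` of a ring with respect to an element `e`, where the index `1` is
encoded as `true` and the index `2` as `false`: left multiplication by `e` is the identity on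
`R_1j` and zero on `R_2j`, and similarly on the right. No unit is needed for this description. -/
def peirce (e : R) (i j : Bool) : AddSubgroup R where
  carrier := {x | e * x = (if i then x else 0) ∧ x * e = if j then x else 0}
  zero_mem' := by simp
  add_mem' := by
    rintro x y ⟨hx, hx'⟩ ⟨hy, hy'⟩
    simp only [Set.mem_ofPred_eq, mul_add, add_mul, hx, hx', hy, hy']
    cases i <;> cases j <;> simp
  neg_mem' := by
    rintro x ⟨hx, hx'⟩
    simp only [Set.mem_ofPred_eq, mul_neg, neg_mul, hx, hx']
    cases i <;> cases j <;> simp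

theorem mem_peirce {e : R} {i j : Bool} {x : R} : x ∈ peirce e i j ↔
    e * x = (if i then x else 0) ∧ x * e = if j then x else 0 := Iff.rfl

theorem eq_zero_of_mem_peirce {i j k l : Bool} {x : R} (h : x ∈ peirce e i j)
    (h' : x ∈ peirce e k l) (hne : i ≠ k ∨ j ≠ l) : x = 0 := by
  obtain ⟨h₁, h₂⟩ := h
  obtain ⟨h₃, h₄⟩ := h'
  rw [h₁] at h₃
  rw [h₂] at h₄
  cases i <;> cases j <;> cases k <;> cases l <;> simp_all

/-- The Peirce decomposition `R = R_11 + R_12 + R_21 + R_22`, in either order of the indices. -/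
theorem IsAlternative.exists_peirce (halt : IsAlternative R) (he : IsIdempotentElem e)
    {i j : Bool} (hij : i ≠ j) (x : R) :
    ∃ a ∈ peirce e i i, ∃ b ∈ peirce e i j, ∃ c ∈ peirce e j i, ∃ d ∈ peirce e j j,
      x = a + b + c + d := by
  have h₁ (y : R) : e * (e * y) = e * y := by rw [halt.self_mul_mul, he.eq]
  have h₂ (y : R) : y * e * e = y * e := by rw [halt.mul_mul_self, he.eq]
  have h₃ : e * (x * e) = e * x * e := (halt.flexible e x).symm
  have h₄ : e * (e * x * e) = e * x * e := by rw [← h₃, h₁]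
  have hTT : e * x * e ∈ peirce e true true := ⟨by simp [h₄], by simp [h₂]⟩
  have hTF : e * x - e * x * e ∈ peirce e true false :=
    ⟨by simp [mul_sub, h₁, h₄], by simp [sub_mul, h₂]⟩
  have hFT : x * e - e * x * e ∈ peirce e false true :=
    ⟨by simp [mul_sub, h₃, h₄], by simp [sub_mul, h₂]⟩
  have hFF : x - e * x - x * e + e * x * e ∈ peirce e false false :=
    ⟨by simp [mul_sub, mul_add, h₁, h₃, h₄], by simp [sub_mul, add_mul, h₂]⟩
  cases i <;> cases j <;> simp only [ne_eq, not_true_eq_false, reduceCtorEq] at hij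
  · exact ⟨_, hFF, _, hFT, _, hTF, _, hTT, by abel⟩
  · exact ⟨_, hTT, _, hTF, _, hFT, _, hFF, by abel⟩

theorem IsAlternative.mul_mem_peirce (halt : IsAlternative R) {i j k : Bool} {x y : R}
    (hx : x ∈ peirce e i j) (hy : y ∈ peirce e j k) : x * y ∈ peirce e i k := by
  have h : associator x e y = 0 := by
    rw [associator, hx.2, hy.1]
    cases j <;> simp
  have h₁ : associator e x y = 0 := by rw [halt.associator_swap_left, h, neg_zero]
  have h₂ : associator x y e = 0 := by rw [halt.associator_swap_right, h, neg_zero]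
  constructor
  · rw [← mul_assoc_of_associator_eq_zero h₁, hx.1]
    cases i <;> simp
  · rw [mul_assoc_of_associator_eq_zero h₂, hy.2]
    cases k <;> simp

/-- Unlike in the associative case, the product of two elements of `R_ij` need not vanish, but it
lies in `R_ji`. -/
theorem IsAlternative.mul_mem_peirce_swap (halt : IsAlternative R) {i j : Bool} (hij : i ≠ j)
    {x y : R} (hx : x ∈ peirce e i j) (hy : y ∈ peirce e i j) : x * y ∈ peirce e j i := by
  have h₁ := halt.associator_swap_left e x y
  have h₂ := halt.associator_swap_right x y e
  simp only [associator, hx.1, hx.2, hy.1, hy.2] at h₁ h₂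
  rw [mem_peirce]
  cases i <;> cases j <;> simp_all

theorem IsAlternative.mul_eq_zero_of_mem_peirce (halt : IsAlternative R) {i j k : Bool}
    (hjk : j ≠ k) {x y : R} (hx : x ∈ peirce e i j) (hy : y ∈ peirce e k i) : x * y = 0 := by
  have h := halt.associator_swap_left x e y
  rw [halt.associator_swap_right e, halt.associator_swap_left e] at h
  simp only [associator, hx.1, hx.2, hy.1, hy.2] at h
  cases i <;> cases j <;> cases k <;> simp_all

theorem IsAlternative.mul_comm_of_mem_peirce (halt : IsAlternative R) {i j : Bool} (hij : i ≠ j)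
    {x y : R} (hx : x ∈ peirce e i j) (hy : y ∈ peirce e i j) : x * y = -(y * x) := by
  have h := halt.associator_swap_left x e y
  rw [halt.associator_swap_right e, halt.associator_swap_left e] at h
  simp only [associator, hx.1, hx.2, hy.1, hy.2] at h
  cases i <;> cases j <;> simp_all [neg_eq_iff_eq_neg]

theorem IsAlternative.mul_eq_zero_of_mem_peirce_diag (halt : IsAlternative R)
    (he : IsIdempotentElem e) {i j : Bool} (hij : i ≠ j) {x y : R} (hx : x ∈ peirce e i i)
    (hy : y ∈ peirce e j j) : x * y = 0 := by
  have key {x y : R} (hx : x ∈ peirce e true true) (hy : y ∈ peirce e false false) :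
      x * y = 0 ∧ y * x = 0 := by
    have h₁ := halt.associator_swap_left e x y
    have h₂ := halt.associator_swap_left e y x
    have h₃ := halt.associator_swap_left x e y
    rw [halt.associator_swap_right e, halt.associator_swap_left e] at h₃
    simp only [associator, hx.1, hx.2, hy.1, hy.2, if_true, Bool.false_eq_true, if_false, zero_mul,
      mul_zero, sub_zero, zero_sub, neg_neg] at h₁ h₂ h₃
    rw [← h₃] at h₂ ⊢
    -- For `p = x y = y x`, both `e p = 2 p` and `e p = -p`; moreover `e (e p) = e p`.
    rw [sub_eq_iff_eq_add, eq_neg_add_iff_add_eq] at h₁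
    rw [neg_eq_iff_eq_neg] at h₂
    have h₆ : e * (e * (x * y)) = e * (x * y) := by rw [halt.self_mul_mul, he.eq]
    rw [h₂, mul_neg, h₂, neg_neg] at h₆
    rw [h₂, ← h₆, add_eq_left] at h₁
    exact ⟨h₁, h₁⟩
  cases i <;> cases j <;> simp only [ne_eq, not_true_eq_false, reduceCtorEq] at hij
  · exact (key hy hx).2
  · exact (key hx hy).1

/-- All products of Peirce components vanish except `R_ij R_jk` and `R_ij R_ij`. -/
theorem IsAlternative.peirce_mul_eq_zero (halt : IsAlternative R) (he : IsIdempotentElem e)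
    {i j k l : Bool} (hjk : j ≠ k) (h : ¬(i = k ∧ j = l)) {x y : R} (hx : x ∈ peirce e i j)
    (hy : y ∈ peirce e k l) : x * y = 0 := by
  cases i <;> cases j <;> cases k <;> cases l <;>
    first
    | simp at hjk h; done
    | exact halt.mul_eq_zero_of_mem_peirce hjk hx hy
    | exact halt.mul_eq_zero_of_mem_peirce_diag he hjk hx hy

/-- Three composable Peirce elements associate as soon as one of them is diagonal, unless they all
lie in the same diagonal component: after exchanging two neighbouring arguments, both products in
the associator vanish. -/
theorem IsAlternative.peirce_mul_assoc (halt : IsAlternative R) (he : IsIdempotentElem e)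
    {i j k l : Bool} (h : i = j ∨ j = k ∨ k = l) (h' : ¬(i = j ∧ j = k ∧ k = l)) {x y z : R}
    (hx : x ∈ peirce e i j) (hy : y ∈ peirce e j k) (hz : z ∈ peirce e k l) :
    x * y * z = x * (y * z) := by
  have hl (h₁ : y * x = 0) (h₂ : y * (x * z) = 0) : x * y * z = x * (y * z) := by
    apply mul_assoc_of_associator_eq_zero
    rw [halt.associator_swap_left, associator, h₁, h₂, zero_mul, sub_zero, neg_zero]
  have hr (h₁ : z * y = 0) (h₂ : x * z * y = 0) : x * y * z = x * (y * z) := by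
    apply mul_assoc_of_associator_eq_zero
    rw [halt.associator_swap_right, associator, h₁, h₂, mul_zero, sub_zero, neg_zero]
  cases i <;> cases j <;> cases k <;> cases l <;>
    first
    | simp at h h'; done
    | refine hl (halt.peirce_mul_eq_zero he (by decide) (by decide) hy hx) ?_
      first
      | rw [halt.peirce_mul_eq_zero he (by decide) (by decide) hx hz, mul_zero]
      | exact halt.peirce_mul_eq_zero he (by decide) (by decide) hy (halt.mul_mem_peirce hx hz)
    | refine hr (halt.peirce_mul_eq_zero he (by decide) (by decide) hz hy) ?_
      first
      | rw [halt.peirce_mul_eq_zero he (by decide) (by decide) hx hz, zero_mul]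
      | exact halt.peirce_mul_eq_zero he (by decide) (by decide) (halt.mul_mem_peirce hx hz) hy

/-! ### Faithfulness of the off-diagonal components -/

/-- A nontrivial idempotent of a prime alternative ring has a nonzero off-diagonal Peirce
component: otherwise `R` is the direct sum of the ideals `R_11` and `R_22`. -/
theorem IsPrimeRing.exists_offdiag_ne_zero (hprime : IsPrimeRing R) (halt : IsAlternative R)
    (he : IsNontrivialIdempotent e) {i j : Bool} (hij : i ≠ j)
    (h₁ : ∀ x ∈ peirce e i j, x = 0) (h₂ : ∀ x ∈ peirce e j i, x = 0) : False := by
  obtain ⟨he0, hee, hne⟩ := he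
  have h {k l : Bool} (hkl : k ≠ l) {x : R} (hx : x ∈ peirce e k l) : x = 0 := by
    cases i <;> cases j <;> cases k <;> cases l <;>
      first
      | exact absurd rfl hij
      | exact absurd rfl hkl
      | exact h₁ x hx
      | exact h₂ x hx
  have hdec (x : R) : ∃ a ∈ peirce e true true, ∃ b ∈ peirce e false false, x = a + b := by
    obtain ⟨a, ha, b, hb, c, hc, d, hd, rfl⟩ := halt.exists_peirce hee (by decide : true ≠ false) x
    exact ⟨a, ha, d, hd, by rw [h (by decide) hb, h (by decide) hc, add_zero, add_zero]⟩
  have hzero {k l : Bool} (hkl : k ≠ l) {x y : R} (hx : x ∈ peirce e k k)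
      (hy : y ∈ peirce e l l) : x * y = 0 := halt.mul_eq_zero_of_mem_peirce_diag hee hkl hx hy
  have hideal (k : Bool) : ∀ r, ∀ x ∈ peirce e k k, r * x ∈ peirce e k k ∧ x * r ∈ peirce e k k := by
    intro r x hx
    obtain ⟨a, ha, b, hb, rfl⟩ := hdec r
    rw [add_mul, mul_add]
    cases k
    · rw [hzero (by decide) ha hx, hzero (by decide) hx ha, zero_add, zero_add]
      exact ⟨halt.mul_mem_peirce hb hx, halt.mul_mem_peirce hx hb⟩
    · rw [hzero (by decide) hb hx, hzero (by decide) hx hb, add_zero, add_zero]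
      exact ⟨halt.mul_mem_peirce ha hx, halt.mul_mem_peirce hx ha⟩
  have hmem : e ∈ peirce e true true := ⟨by simp [hee.eq], by simp [hee.eq]⟩
  rcases hprime.eq_bot_or_eq_bot _ _ (hideal true) (hideal false)
    (fun a ha b hb => hzero (by decide) ha hb) with h | h
  · exact he0 (h e hmem)
  · refine hne fun x => ?_
    obtain ⟨a, ha, b, hb, rfl⟩ := hdec x
    rw [h b hb, add_zero]
    exact ⟨by simpa using ha.1, by simpa using ha.2⟩

/-- One-sided faithfulness of the diagonal components: if `R_ji p = 0` then `p = 0`. The elements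
`p + q` with `p ∈ R_ii`, `q ∈ R_ij` and `R_ji p = R_ji q = R_ij q = 0` form an ideal which is
annihilated from the left by the off-diagonal components. -/
theorem IsPrimeRing.eq_zero_of_offdiag_mul (hprime : IsPrimeRing R) (halt : IsAlternative R)
    (he : IsNontrivialIdempotent e) {i j : Bool} (hij : i ≠ j) {p : R} (hp : p ∈ peirce e i i)
    (h : ∀ y ∈ peirce e j i, y * p = 0) : p = 0 := by
  have hee := he.2.1
  let K : AddSubgroup R :=
    { carrier := {k | ∃ p ∈ peirce e i i, ∃ q ∈ peirce e i j, (∀ y ∈ peirce e j i, y * p = 0) ∧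
        (∀ y ∈ peirce e j i, y * q = 0) ∧ (∀ x ∈ peirce e i j, x * q = 0) ∧ k = p + q}
      zero_mem' := ⟨0, zero_mem _, 0, zero_mem _, by simp, by simp, by simp, by simp⟩
      add_mem' := by
        rintro _ _ ⟨p, hp, q, hq, h₁, h₂, h₃, rfl⟩ ⟨p', hp', q', hq', h₁', h₂', h₃', rfl⟩
        refine ⟨p + p', add_mem hp hp', q + q', add_mem hq hq', fun y hy => ?_, fun y hy => ?_,
          fun x hx => ?_, by abel⟩
        · rw [mul_add, h₁ y hy, h₁' y hy, add_zero]
        · rw [mul_add, h₂ y hy, h₂' y hy, add_zero]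
        · rw [mul_add, h₃ x hx, h₃' x hx, add_zero]
      neg_mem' := by
        rintro _ ⟨p, hp, q, hq, h₁, h₂, h₃, rfl⟩
        refine ⟨-p, neg_mem hp, -q, neg_mem hq, fun y hy => ?_, fun y hy => ?_,
          fun x hx => ?_, by abel⟩
        · rw [mul_neg, h₁ y hy, neg_zero]
        · rw [mul_neg, h₂ y hy, neg_zero]
        · rw [mul_neg, h₃ x hx, neg_zero] }
  have zero {a b c d : Bool} {x y : R} (hx : x ∈ peirce e a b) (hy : y ∈ peirce e c d)
      (h₁ : b ≠ c := by first | exact hij | exact hij.symm)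
      (h₂ : ¬(a = c ∧ b = d) := by simp [hij, hij.symm]) : x * y = 0 :=
    halt.peirce_mul_eq_zero hee h₁ h₂ hx hy
  have assoc {a b c d : Bool} {x y z : R} (hx : x ∈ peirce e a b) (hy : y ∈ peirce e b c)
      (hz : z ∈ peirce e c d) (h₁ : a = b ∨ b = c ∨ c = d := by simp)
      (h₂ : ¬(a = b ∧ b = c ∧ c = d) := by simp [hij, hij.symm]) : x * y * z = x * (y * z) :=
    halt.peirce_mul_assoc hee h₁ h₂ hx hy hz
  have hK : ∀ r, ∀ k ∈ K, r * k ∈ K ∧ k * r ∈ K := by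
    rintro r _ ⟨p, hp, q, hq, h₁, h₂, h₃, rfl⟩
    obtain ⟨a, ha, b, hb, c, hc, d, hd, rfl⟩ := halt.exists_peirce hee hij r
    have hqz {x : R} (hx : x ∈ peirce e i j) : q * x = 0 := by
      rw [halt.mul_comm_of_mem_peirce hij hq hx, h₃ x hx, neg_zero]
    constructor
    · refine ⟨a * p, halt.mul_mem_peirce ha hp, a * q, halt.mul_mem_peirce ha hq,
        fun y hy => ?_, fun y hy => ?_, fun x hx => ?_, ?_⟩
      · rw [← assoc hy ha hp, h₁ _ (halt.mul_mem_peirce hy ha)]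
      · rw [← assoc hy ha hq, h₂ _ (halt.mul_mem_peirce hy ha)]
      · have : associator x a q = 0 := by
          rw [halt.associator_swap_right, associator, h₃ x hx, zero hq ha, zero_mul, mul_zero,
            sub_zero, neg_zero]
        rw [← mul_assoc_of_associator_eq_zero this, zero hx ha, zero_mul]
      · simp only [add_mul, mul_add, h₁ c hc, h₂ c hc, h₃ b hb, zero hb hp, zero hd hp, zero hd hq]
        abel
    · refine ⟨p * a + q * c, add_mem (halt.mul_mem_peirce hp ha) (halt.mul_mem_peirce hq hc),
        p * b + q * d, add_mem (halt.mul_mem_peirce hp hb) (halt.mul_mem_peirce hq hd),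
        fun y hy => ?_, fun y hy => ?_, fun x hx => ?_, ?_⟩
      · have : associator y q c = 0 := by
          rw [halt.associator_rotate, associator, zero (halt.mul_mem_peirce hq hc) hy,
            hqz (halt.mul_mem_peirce_swap hij.symm hc hy), sub_zero]
        rw [mul_add, ← assoc hy hp ha, h₁ y hy, ← mul_assoc_of_associator_eq_zero this, h₂ y hy]
        simp
      · rw [mul_add, ← assoc hy hp hb, h₁ y hy, ← assoc hy hq hd, h₂ y hy]
        simp
      · have hpb : associator x p b = 0 := by
          rw [← halt.associator_rotate, associator,
            h₁ _ (halt.mul_mem_peirce_swap hij hb hx), zero hx hp, mul_zero, sub_zero]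
        have hqd : associator x q d = 0 := by
          rw [halt.associator_swap_right, associator, h₃ _ (halt.mul_mem_peirce hx hd),
            zero hd hq, mul_zero, sub_zero, neg_zero]
        rw [mul_add, ← mul_assoc_of_associator_eq_zero hpb, zero hx hp,
          ← mul_assoc_of_associator_eq_zero hqd, h₃ x hx]
        simp
      · simp only [add_mul, mul_add, hqz hb, zero hp hc, zero hp hd, zero hq ha]
        abel
  by_contra hp0
  have hpK : p ∈ K := ⟨p, hp, 0, zero_mem _, h, by simp, by simp, by simp⟩
  apply hprime.exists_offdiag_ne_zero halt he hij
  · refine fun x hx => hprime.eq_zero_of_mul_ideal halt K hK hpK hp0 ?_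
    rintro _ ⟨p, hp, q, hq, h₁, h₂, h₃, rfl⟩
    rw [mul_add, zero hx hp, h₃ x hx, add_zero]
  · refine fun y hy => hprime.eq_zero_of_mul_ideal halt K hK hpK hp0 ?_
    rintro _ ⟨p, hp, q, hq, h₁, h₂, h₃, rfl⟩
    rw [mul_add, h₁ y hy, h₂ y hy, add_zero]

/-- The mirror image of `IsPrimeRing.eq_zero_of_offdiag_mul`, obtained from the opposite ring. -/
theorem IsPrimeRing.eq_zero_of_mul_offdiag (hprime : IsPrimeRing R) (halt : IsAlternative R)
    (he : IsNontrivialIdempotent e) {i j : Bool} (hij : i ≠ j) {p : R} (hp : p ∈ peirce e i i)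
    (h : ∀ x ∈ peirce e i j, p * x = 0) : p = 0 := by
  have hop : IsNontrivialIdempotent (MulOpposite.op e) := by
    refine ⟨by simpa using he.1, congrArg MulOpposite.op he.2.1, fun h => he.2.2 fun x => ?_⟩
    have := h (.op x)
    simp only [← MulOpposite.op_mul, MulOpposite.op_inj] at this
    exact this.symm
  have hmem {k l : Bool} {x : Rᵐᵒᵖ} : x ∈ peirce (MulOpposite.op e) k l ↔ x.unop ∈ peirce e l k := by
    rw [mem_peirce, mem_peirce, and_comm, ← MulOpposite.unop_inj, ← MulOpposite.unop_inj]
    cases k <;> cases l <;> simp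
  have := hprime.op.eq_zero_of_offdiag_mul halt.op hop hij (p := .op p) (hmem.2 hp) fun y hy =>
    MulOpposite.unop_injective (h _ (hmem.1 hy))
  simpa using this

/-- An off-diagonal element `h ∈ R_ij` with `h R_ji = R_ji h = 0` vanishes. Together with the
corresponding elements of `R_ji`, these elements form an ideal `L`, with `(L L) L = 0`. -/
theorem IsPrimeRing.eq_zero_of_offdiag (hprime : IsPrimeRing R) (halt : IsAlternative R)
    (he : IsIdempotentElem e) {i j : Bool} (hij : i ≠ j) {h : R} (hh : h ∈ peirce e i j)
    (h₁ : ∀ y ∈ peirce e j i, h * y = 0) (h₂ : ∀ y ∈ peirce e j i, y * h = 0) : h = 0 := by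
  have zero {a b c d : Bool} {x y : R} (hx : x ∈ peirce e a b) (hy : y ∈ peirce e c d)
      (h₁ : b ≠ c) (h₂ : ¬(a = c ∧ b = d)) : x * y = 0 :=
    halt.peirce_mul_eq_zero he h₁ h₂ hx hy
  have assoc {a b c d : Bool} {x y z : R} (hx : x ∈ peirce e a b) (hy : y ∈ peirce e b c)
      (hz : z ∈ peirce e c d) (h₁ : a = b ∨ b = c ∨ c = d)
      (h₂ : ¬(a = b ∧ b = c ∧ c = d)) : x * y * z = x * (y * z) :=
    halt.peirce_mul_assoc he h₁ h₂ hx hy hz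
  -- Both orders of the indices are needed, since `N i j * R_ij` lies in `N j i`.
  let N (i j : Bool) : AddSubgroup R :=
    { carrier := {h | h ∈ peirce e i j ∧ ∀ y ∈ peirce e j i, h * y = 0 ∧ y * h = 0}
      zero_mem' := ⟨zero_mem _, by simp⟩
      add_mem' := by
        rintro x x' ⟨hx, hx0⟩ ⟨hx', hx0'⟩
        refine ⟨add_mem hx hx', fun y hy => ?_⟩
        rw [add_mul, mul_add, (hx0 y hy).1, (hx0 y hy).2, (hx0' y hy).1, (hx0' y hy).2]
        simp
      neg_mem' := by
        rintro x ⟨hx, hx0⟩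
        refine ⟨neg_mem hx, fun y hy => ?_⟩
        rw [neg_mul, mul_neg, (hx0 y hy).1, (hx0 y hy).2]
        simp }
  have hN {i j : Bool} (hij : i ≠ j) {h : R} (hh : h ∈ N i j) {x : R} (hx : x ∈ peirce e i j) :
      h * x ∈ N j i := by
    obtain ⟨hh, h0⟩ := hh
    have key {x z : R} (hx : x ∈ peirce e i j) (hz : z ∈ peirce e i j) :
        h * x * z = 0 ∧ associator h x z = 0 := by
      have hxz := h0 _ (halt.mul_mem_peirce_swap hij hx hz)
      have h₃ : associator h x z = h * x * z := by rw [associator, hxz.1, sub_zero]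
      have h₄ : associator h x z = -(x * (z * h)) := by
        rw [halt.associator_rotate, associator, hxz.2, zero_sub]
      -- The associator is `(h x) z ∈ R_jj` and, after a rotation, `-x (z h) ∈ R_ii`.
      have h₅ : h * x * z = 0 := by
        refine eq_zero_of_mem_peirce (k := i) (l := i)
          (halt.mul_mem_peirce (halt.mul_mem_peirce_swap hij hh hx) hz) ?_ (.inl hij.symm)
        rw [← h₃, h₄]
        exact neg_mem (halt.mul_mem_peirce hx (halt.mul_mem_peirce_swap hij hz hh))
      exact ⟨h₅, h₃.trans h₅⟩
    refine ⟨halt.mul_mem_peirce_swap hij hh hx, fun z hz => ⟨(key hx hz).1, ?_⟩⟩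
    have := (key hx hz).2
    rw [← halt.associator_rotate, associator, halt.mul_comm_of_mem_peirce hij hz hh, neg_mul,
      (key hz hx).1, neg_zero, zero_sub, neg_eq_zero] at this
    exact this
  have hideal {i j : Bool} (hij : i ≠ j) {h : R} (hh : h ∈ N i j) (r : R) :
      (∃ u ∈ N i j, ∃ v ∈ N j i, u + v = r * h) ∧ ∃ u ∈ N i j, ∃ v ∈ N j i, u + v = h * r := by
    have hhx {x : R} (hx : x ∈ peirce e i j) : h * x ∈ N j i := hN hij hh hx
    obtain ⟨hh, h0⟩ := hh
    obtain ⟨a, ha, b, hb, c, hc, d, hd, rfl⟩ := halt.exists_peirce he hij r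
    refine ⟨⟨a * h, ⟨halt.mul_mem_peirce ha hh, fun y hy => ⟨?_, ?_⟩⟩, b * h, ?_, ?_⟩,
      ⟨h * d, ⟨halt.mul_mem_peirce hh hd, fun y hy => ⟨?_, ?_⟩⟩, h * b, hhx hb, ?_⟩⟩
    · rw [assoc ha hh hy (by simp) (by simp [hij]), (h0 y hy).1, mul_zero]
    · rw [← assoc hy ha hh (by simp) (by simp [hij]), (h0 _ (halt.mul_mem_peirce hy ha)).2]
    · rw [halt.mul_comm_of_mem_peirce hij hb hh]
      exact neg_mem (hhx hb)
    · simp [add_mul, (h0 c hc).2, zero hd hh hij.symm (by simp [hij.symm])]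
    · rw [assoc hh hd hy (by simp) (by simp [hij]), (h0 _ (halt.mul_mem_peirce hd hy)).1]
    · rw [← assoc hy hh hd (by simp) (by simp [hij]), (h0 y hy).2, zero_mul]
    · simp [mul_add, (h0 c hc).1, zero hh ha hij.symm (by simp [hij.symm]), add_comm]
  have hL : ∀ r, ∀ m ∈ N i j ⊔ N j i, r * m ∈ N i j ⊔ N j i ∧ m * r ∈ N i j ⊔ N j i := by
    intro r m hm
    obtain ⟨u, hu, v, hv, rfl⟩ := AddSubgroup.mem_sup.1 hm
    have h₃ := hideal hij hu r
    have h₄ := hideal hij.symm hv r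
    rw [← AddSubgroup.mem_sup, ← AddSubgroup.mem_sup] at h₃ h₄
    rw [sup_comm (N j i)] at h₄
    rw [mul_add, add_mul]
    exact ⟨add_mem h₃.1 h₄.1, add_mem h₃.2 h₄.2⟩
  have hhN : h ∈ N i j := ⟨hh, fun y hy => ⟨h₁ y hy, h₂ y hy⟩⟩
  have hhL : h ∈ N i j ⊔ N j i := AddSubgroup.mem_sup_left hhN
  by_contra hne
  -- With `L = N i j ⊔ N j i` nonzero, `(u v) L = 0` gives `u v = 0`.
  have hmul {u v : R} (hu : u ∈ N i j) (hv : v ∈ N i j) : u * v = 0 := by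
    refine hprime.eq_zero_of_mul_ideal halt _ hL hhL hne fun m hm => ?_
    obtain ⟨x, hx, y, hy, rfl⟩ := AddSubgroup.mem_sup.1 hm
    have : associator u v y = 0 := by
      rw [halt.associator_rotate, associator, (hv.2 y hy.1).1, (hu.2 y hy.1).2]
      simp
    rw [mul_add, ((hN hij hu hv.1).2 x hx.1).1, mul_assoc_of_associator_eq_zero this,
      (hv.2 y hy.1).1]
    simp
  refine hne (hprime.eq_zero_of_mul_ideal halt _ hL hhL hne fun m hm => ?_)
  obtain ⟨x, hx, y, hy, rfl⟩ := AddSubgroup.mem_sup.1 hm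
  rw [mul_add, hmul hhN hx, h₁ y hy.1, add_zero]

/-- A diagonal element that commutes with one off-diagonal component commutes with everything: the
hypothesis says that `f + g` commutes with `R_ji`. It follows that `R_ji [f, R_ii] = 0` and
`[g, R_jj] R_ji = 0`, so both commutators vanish; then `f b - b g` is annihilated by `R_ji` on both
sides for each `b ∈ R_ij`, and vanishes too. -/
theorem IsPrimeRing.lie_eq_zero_of_offdiag (hprime : IsPrimeRing R) (halt : IsAlternative R)
    (he : IsNontrivialIdempotent e) {i j : Bool} (hij : i ≠ j) {f g : R} (hf : f ∈ peirce e i i)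
    (hg : g ∈ peirce e j j) (h : ∀ y ∈ peirce e j i, g * y = y * f) (x : R) :
    ⁅x, f + g⁆ = 0 := by
  have hee := he.2.1
  have zero {a b c d : Bool} {x y : R} (hx : x ∈ peirce e a b) (hy : y ∈ peirce e c d)
      (h₁ : b ≠ c := by first | exact hij | exact hij.symm)
      (h₂ : ¬(a = c ∧ b = d) := by simp [hij, hij.symm]) : x * y = 0 :=
    halt.peirce_mul_eq_zero hee h₁ h₂ hx hy
  have assoc {a b c d : Bool} {x y z : R} (hx : x ∈ peirce e a b) (hy : y ∈ peirce e b c)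
      (hz : z ∈ peirce e c d) (h₁ : a = b ∨ b = c ∨ c = d := by simp)
      (h₂ : ¬(a = b ∧ b = c ∧ c = d) := by simp [hij, hij.symm]) : x * y * z = x * (y * z) :=
    halt.peirce_mul_assoc hee h₁ h₂ hx hy hz
  have hfa {a : R} (ha : a ∈ peirce e i i) : f * a = a * f := by
    rw [← sub_eq_zero]
    refine hprime.eq_zero_of_offdiag_mul halt he hij
      (sub_mem (halt.mul_mem_peirce hf ha) (halt.mul_mem_peirce ha hf)) fun y hy => ?_
    rw [mul_sub, ← assoc hy hf ha, ← h y hy, assoc hg hy ha, h _ (halt.mul_mem_peirce hy ha),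
      assoc hy ha hf, sub_self]
  have hgd {d : R} (hd : d ∈ peirce e j j) : g * d = d * g := by
    rw [← sub_eq_zero]
    refine hprime.eq_zero_of_mul_offdiag halt he hij.symm
      (sub_mem (halt.mul_mem_peirce hg hd) (halt.mul_mem_peirce hd hg)) fun y hy => ?_
    rw [sub_mul, assoc hg hd hy, h _ (halt.mul_mem_peirce hd hy), assoc hd hy hf, ← h y hy,
      assoc hd hg hy, sub_self]
  have hb {b : R} (hb : b ∈ peirce e i j) : f * b = b * g := by
    rw [← sub_eq_zero]
    refine hprime.eq_zero_of_offdiag halt hee hij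
      (sub_mem (halt.mul_mem_peirce hf hb) (halt.mul_mem_peirce hb hg)) (fun y hy => ?_)
      fun y hy => ?_
    · rw [sub_mul, assoc hf hb hy, hfa (halt.mul_mem_peirce hb hy), assoc hb hg hy, h y hy,
        assoc hb hy hf, sub_self]
    · rw [mul_sub, ← assoc hy hf hb, ← h y hy, assoc hg hy hb, hgd (halt.mul_mem_peirce hy hb),
        assoc hy hb hg, sub_self]
  obtain ⟨a, ha, b, hb', c, hc, d, hd, rfl⟩ := halt.exists_peirce hee hij x
  simp only [Ring.lie_def, add_mul, mul_add, hfa ha, hgd hd, hb hb', h c hc, zero ha hg,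
    zero hg ha, zero hb' hf, zero hg hb', zero hf hc, zero hc hg, zero hd hf, zero hf hd]
  abel

/-! ### Commutators and the Peirce decomposition -/

theorem zero_bracket (x : R) : ⁅(0 : R), x⁆ = 0 := by simp [Ring.lie_def]

theorem add_bracket (x y z : R) : ⁅x + y, z⁆ = ⁅x, z⁆ + ⁅y, z⁆ := by
  simp only [Ring.lie_def, add_mul, mul_add]; abel

theorem bracket_add (x y z : R) : ⁅x, y + z⁆ = ⁅x, y⁆ + ⁅x, z⁆ := by
  simp only [Ring.lie_def, add_mul, mul_add]; abel

theorem neg_bracket (x y : R) : ⁅-x, y⁆ = -⁅x, y⁆ := by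
  simp only [Ring.lie_def, neg_mul, mul_neg]; abel

theorem bracket_neg (x y : R) : ⁅x, -y⁆ = -⁅x, y⁆ := by
  simp only [Ring.lie_def, neg_mul, mul_neg]; abel

theorem bracket_skew (x y : R) : -⁅y, x⁆ = ⁅x, y⁆ := by simp [Ring.lie_def]

/-- Elements commuting with the idempotent `e` are diagonal. -/
theorem IsAlternative.exists_diag (halt : IsAlternative R) (he : IsIdempotentElem e) {i j : Bool}
    (hij : i ≠ j) {f : R} (hf : Commute e f) :
    ∃ a ∈ peirce e i i, ∃ d ∈ peirce e j j, f = a + d := by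
  obtain ⟨a, ha, b, hb, c, hc, d, hd, rfl⟩ := halt.exists_peirce he hij f
  have key {b c : R} (hb : b ∈ peirce e true false) (hc : c ∈ peirce e false true)
      (h : e * b + e * c = b * e + c * e) : b = 0 ∧ c = 0 := by
    simp only [hb.1, hb.2, hc.1, hc.2] at h
    simp only [if_true, Bool.false_eq_true, if_false, add_zero, zero_add] at h
    have hb0 := eq_zero_of_mem_peirce hb (h ▸ hc) (.inl (by decide))
    exact ⟨hb0, h ▸ hb0⟩
  have h : e * b + e * c = b * e + c * e := by
    have h := hf.eq
    have ha' : e * a = a * e := by rw [ha.1, ha.2]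
    have hd' : e * d = d * e := by rw [hd.1, hd.2]
    simp only [mul_add, add_mul, ha', hd'] at h
    rw [add_left_inj, add_assoc, add_assoc, add_right_inj] at h
    exact h
  have h0 : b = 0 ∧ c = 0 := by
    cases i <;> cases j <;> simp only [ne_eq, not_true_eq_false, reduceCtorEq] at hij
    · exact (key hc hb (by rw [add_comm, h, add_comm])).symm
    · exact key hb hc h
  exact ⟨a, ha, d, hd, by rw [h0.1, h0.2, add_zero, add_zero]⟩

theorem commute_of_mem_peirce {i : Bool} {a : R} (ha : a ∈ peirce e i i) : Commute e a := by
  rw [commute_iff_eq, ha.1, ha.2]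

theorem bracket_bracket_eq_zero {f : R} (hf : Commute e f) : ⁅⁅f, e⁆, e⁆ = 0 := by
  simp [Ring.lie_def, hf.eq]

theorem bracket_bracket_eq_self {i j : Bool} (hij : i ≠ j) {x : R} (hx : x ∈ peirce e i j) :
    ⁅⁅x, e⁆, e⁆ = x := by
  simp only [Ring.lie_def, sub_mul, mul_sub, hx.1, hx.2]
  cases i <;> cases j <;> simp_all [hx.1, hx.2, mem_peirce]

theorem IsAlternative.commute_of_bracket_bracket (halt : IsAlternative R)
    (he : IsIdempotentElem e) {f : R} (hf : ⁅⁅f, e⁆, e⁆ = 0) : Commute e f := by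
  obtain ⟨a, ha, b, hb, c, hc, d, hd, rfl⟩ := halt.exists_peirce he (by decide : true ≠ false) f
  simp only [add_bracket] at hf
  rw [bracket_bracket_eq_zero (commute_of_mem_peirce ha),
    bracket_bracket_eq_zero (commute_of_mem_peirce hd), bracket_bracket_eq_self (by decide) hb,
    bracket_bracket_eq_self (by decide) hc, zero_add, add_zero] at hf
  rw [add_assoc a, hf, add_zero]
  exact (commute_of_mem_peirce ha).add_right (commute_of_mem_peirce hd)

/-- Off-diagonal elements are commutators. -/
theorem exists_bracket_eq {i j : Bool} (hij : i ≠ j) {x : R} (hx : x ∈ peirce e i j) :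
    ∃ u v : R, ⁅u, v⁆ = x := ⟨_, _, bracket_bracket_eq_self hij hx⟩

theorem IsAlternative.bracket_diag_mem (halt : IsAlternative R) (he : IsIdempotentElem e)
    {i j : Bool} (hij : i ≠ j) {x a : R} (hx : x ∈ peirce e i j) (hea : Commute e a) :
    ⁅x, a⁆ ∈ peirce e i j := by
  obtain ⟨a, ha, d, hd, rfl⟩ := halt.exists_diag he hij hea
  rw [Ring.lie_def, mul_add, add_mul, halt.peirce_mul_eq_zero he hij.symm (by simp [hij.symm]) hx ha,
    halt.peirce_mul_eq_zero he hij.symm (by simp [hij.symm]) hd hx, zero_add, add_zero]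
  exact sub_mem (halt.mul_mem_peirce hx hd) (halt.mul_mem_peirce ha hx)

theorem IsAlternative.commute_bracket (halt : IsAlternative R) {i j : Bool} {x y : R}
    (hx : x ∈ peirce e i j) (hy : y ∈ peirce e j i) : Commute e ⁅x, y⁆ :=
  (commute_of_mem_peirce (halt.mul_mem_peirce hx hy)).sub_right
    (commute_of_mem_peirce (halt.mul_mem_peirce hy hx))

theorem IsAlternative.bracket_mem_swap (halt : IsAlternative R) {i j : Bool} (hij : i ≠ j)
    {x y : R} (hx : x ∈ peirce e i j) (hy : y ∈ peirce e i j) : ⁅x, y⁆ ∈ peirce e j i :=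
  sub_mem (halt.mul_mem_peirce_swap hij hx hy) (halt.mul_mem_peirce_swap hij hy hx)

/-- A diagonal element `f` commutes with everything once `[x, f]` is diagonal for all `x` in one
off-diagonal component. -/
theorem IsPrimeRing.bracket_eq_zero_of_commute (hprime : IsPrimeRing R) (halt : IsAlternative R)
    (he : IsNontrivialIdempotent e) {i j : Bool} (hij : i ≠ j) {f : R} (hf : Commute e f)
    (h : ∀ y ∈ peirce e i j, Commute e ⁅y, f⁆) (x : R) : ⁅x, f⁆ = 0 := by
  have hz (y) (hy : y ∈ peirce e i j) : ⁅y, f⁆ = 0 := by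
    rw [← bracket_bracket_eq_self hij (halt.bracket_diag_mem he.2.1 hij hy hf),
      bracket_bracket_eq_zero (h y hy)]
  obtain ⟨a, ha, d, hd, rfl⟩ := halt.exists_diag he.2.1 hij.symm hf
  refine hprime.lie_eq_zero_of_offdiag halt he hij.symm ha hd (fun y hy => ?_) x
  have := hz y hy
  rw [Ring.lie_def, mul_add, add_mul,
    halt.peirce_mul_eq_zero he.2.1 hij.symm (by simp [hij.symm]) hy hd,
    halt.peirce_mul_eq_zero he.2.1 hij.symm (by simp [hij.symm]) ha hy, zero_add, add_zero,
    sub_eq_zero] at this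
  exact this.symm

/-! ### The additivity defect -/

/-- The defect of additivity of a map `D` at the pair `a`, `b`. -/
def defect (D : R → R) (a b : R) : R := D (a + b) - D a - D b

theorem map_add_of_defect_eq_zero {a b : R} (h : defect D a b = 0) : D (a + b) = D a + D b := by
  rwa [defect, sub_sub, sub_eq_zero] at h

theorem defect_comm (D : R → R) (a b : R) : defect D a b = defect D b a := by
  rw [defect, defect, add_comm a b]; abel

theorem IsLieTripleDerivable.map_zero (hD : IsLieTripleDerivable D) : D 0 = 0 := by
  simpa [Ring.lie_def] using hD 0 0 0

theorem IsLieTripleDerivable.defect_zero_right (hD : IsLieTripleDerivable D) (a : R) :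
    defect D a 0 = 0 := by simp [defect, hD.map_zero]

/-- The derivation terms cancel in the defect: it is equivariant under the additive maps
`a ↦ [[a, y], z]`. All later arguments use `D` only through this lemma, its analogue
`bracket_defect` for `a ↦ [[x, y], a]`, and the defining identity of `D`. -/
theorem IsLieTripleDerivable.bracket_bracket_defect (hD : IsLieTripleDerivable D) (a b y z : R) :
    ⁅⁅defect D a b, y⁆, z⁆ = defect D ⁅⁅a, y⁆, z⁆ ⁅⁅b, y⁆, z⁆ := by
  have h := hD (a + b) y z
  simp only [add_bracket] at h
  rw [defect, defect, h, hD a, hD b]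
  simp only [Ring.lie_def, sub_mul, mul_sub]
  abel

theorem IsLieTripleDerivable.bracket_defect (hD : IsLieTripleDerivable D) (x y a b : R) :
    ⁅⁅x, y⁆, defect D a b⁆ = defect D ⁅⁅x, y⁆, a⁆ ⁅⁅x, y⁆, b⁆ := by
  have h := hD x y (a + b)
  simp only [bracket_add] at h
  rw [defect, defect, h, hD x y a, hD x y b]
  simp only [Ring.lie_def, sub_mul, mul_sub]
  abel

theorem IsLieTripleDerivable.map_add_bracket (hD : IsLieTripleDerivable D) {a b : R}
    (h : ∀ x : R, ⁅x, defect D a b⁆ = 0) (y z : R) :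
    D (⁅⁅a, y⁆, z⁆ + ⁅⁅b, y⁆, z⁆) = D ⁅⁅a, y⁆, z⁆ + D ⁅⁅b, y⁆, z⁆ := by
  apply map_add_of_defect_eq_zero
  rw [← hD.bracket_bracket_defect, ← bracket_skew (defect D a b), h, neg_zero, zero_bracket]

theorem IsLieTripleDerivable.map_bracket_add (hD : IsLieTripleDerivable D) {a b : R}
    (h : ∀ x : R, ⁅x, defect D a b⁆ = 0) (y z : R) :
    D (⁅⁅y, a⁆, z⁆ + ⁅⁅y, b⁆, z⁆) = D ⁅⁅y, a⁆, z⁆ + D ⁅⁅y, b⁆, z⁆ := by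
  have h₁ := hD y (a + b) z
  have h₂ : ⁅⁅y, defect D a b⁆, z⁆ = 0 := by rw [h, zero_bracket]
  simp only [bracket_add, add_bracket] at h₁
  rw [h₁, hD y a, hD y b, ← sub_eq_zero, ← h₂, defect]
  simp only [Ring.lie_def, sub_mul, mul_sub]
  abel

/-- If the defects of `D` at `(a, a')` and `(b, b')` commute with everything, then `D` is additive
on the four terms of `[[a + a', b + b'], z]`. -/
theorem IsLieTripleDerivable.map_add_bracket_add (hD : IsLieTripleDerivable D) {a a' b b' : R}
    (h : ∀ x : R, ⁅x, defect D a a'⁆ = 0) (h' : ∀ x : R, ⁅x, defect D b b'⁆ = 0) (z : R) :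
    D ⁅⁅a + a', b + b'⁆, z⁆ = D ⁅⁅a, b⁆, z⁆ + D ⁅⁅a, b'⁆, z⁆ + (D ⁅⁅a', b⁆, z⁆ + D ⁅⁅a', b'⁆, z⁆) := by
  rw [← hD.map_bracket_add h', ← hD.map_bracket_add h', add_bracket, add_bracket,
    hD.map_add_bracket h, bracket_add, bracket_add, add_bracket, add_bracket]

/-! ### Central defects -/

/-- The map `[[·, e], e]` kills the diagonal part and fixes the off-diagonal part, so a defect with a
diagonal argument has no off-diagonal part. -/
theorem IsLieTripleDerivable.commute_defect (hD : IsLieTripleDerivable D) (halt : IsAlternative R)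
    (he : IsIdempotentElem e) (a : R) {b : R} (hb : Commute e b) : Commute e (defect D a b) := by
  apply halt.commute_of_bracket_bracket he
  rw [hD.bracket_bracket_defect, bracket_bracket_eq_zero hb, hD.defect_zero_right]

/-- A defect commutes with everything if it is diagonal and, for all `y` in one off-diagonal
component, the defect at `([y, a], [y, b])` is diagonal as well. -/
theorem IsLieTripleDerivable.bracket_defect_eq_zero (hD : IsLieTripleDerivable D)
    (hprime : IsPrimeRing R) (halt : IsAlternative R) (he : IsNontrivialIdempotent e)
    {i j : Bool} (hij : i ≠ j) {a b : R} (hab : Commute e (defect D a b))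
    (h : ∀ y ∈ peirce e i j, Commute e (defect D ⁅y, a⁆ ⁅y, b⁆)) (x : R) :
    ⁅x, defect D a b⁆ = 0 := by
  refine hprime.bracket_eq_zero_of_commute halt he hij hab (fun y hy => ?_) x
  obtain ⟨u, v, rfl⟩ := exists_bracket_eq hij hy
  rw [hD.bracket_defect]
  exact h _ hy

theorem IsLieTripleDerivable.bracket_defect_diag_offdiag (hD : IsLieTripleDerivable D)
    (hprime : IsPrimeRing R) (halt : IsAlternative R) (he : IsNontrivialIdempotent e)
    {i j : Bool} (hij : i ≠ j) {a b : R} (ha : Commute e a) (hb : b ∈ peirce e i j) (x : R) :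
    ⁅x, defect D a b⁆ = 0 := by
  refine hD.bracket_defect_eq_zero hprime halt he hij.symm ?_ (fun y hy => ?_) x
  · rw [defect_comm]
    exact hD.commute_defect halt he.2.1 b ha
  · exact hD.commute_defect halt he.2.1 _ (halt.commute_bracket hy hb)

/-- `D` is additive on `R_ij + R_ji`, because `a + b = [[e + a, e - b], e]`. -/
theorem IsLieTripleDerivable.defect_offdiag_eq_zero (hD : IsLieTripleDerivable D)
    (hprime : IsPrimeRing R) (halt : IsAlternative R) (he : IsNontrivialIdempotent e)
    {i j : Bool} (hij : i ≠ j) {a b : R} (ha : a ∈ peirce e i j) (hb : b ∈ peirce e j i) :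
    defect D a b = 0 := by
  have hee : Commute e e := Commute.refl e
  have h := hD.map_add_bracket_add
    (hD.bracket_defect_diag_offdiag hprime halt he hij hee ha)
    (hD.bracket_defect_diag_offdiag hprime halt he hij.symm hee (neg_mem hb)) e
  have h₁ : ⁅⁅e, e⁆, e⁆ = 0 := bracket_bracket_eq_zero hee
  have h₂ : ⁅⁅e, -b⁆, e⁆ = b := by
    rw [bracket_neg, bracket_skew, bracket_bracket_eq_self hij.symm hb]
  have h₃ : ⁅⁅a, e⁆, e⁆ = a := bracket_bracket_eq_self hij ha
  have h₄ : ⁅⁅a, -b⁆, e⁆ = 0 := by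
    rw [Ring.lie_def, (halt.commute_bracket ha (neg_mem hb)).eq, sub_self]
  rw [add_bracket, bracket_add, bracket_add, add_bracket, add_bracket, add_bracket, h₁, h₂, h₃, h₄,
    hD.map_zero, zero_add, zero_add, add_zero, add_zero, add_comm] at h
  rw [defect, h]
  abel

/-- `D` is additive on `R_ij`, because `b + a + [[a, b], e] = [[e - a, -e - b], e]`, where the last
term on the left lies in `R_ji`. -/
theorem IsLieTripleDerivable.defect_same_offdiag_eq_zero (hD : IsLieTripleDerivable D)
    (hprime : IsPrimeRing R) (halt : IsAlternative R) (he : IsNontrivialIdempotent e)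
    {i j : Bool} (hij : i ≠ j) {a b : R} (ha : a ∈ peirce e i j) (hb : b ∈ peirce e i j) :
    defect D a b = 0 := by
  have hee : Commute e e := Commute.refl e
  have h := hD.map_add_bracket_add (a := e) (a' := -a) (b := -e) (b' := -b)
    (hD.bracket_defect_diag_offdiag hprime halt he hij hee (neg_mem ha))
    (hD.bracket_defect_diag_offdiag hprime halt he hij hee.neg_right (neg_mem hb)) e
  have h₁ : ⁅⁅e, -e⁆, e⁆ = 0 := by simp [Ring.lie_def]
  have h₂ : ⁅⁅e, -b⁆, e⁆ = b := by
    rw [bracket_neg, bracket_skew, bracket_bracket_eq_self hij hb]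
  have h₃ : ⁅⁅-a, -e⁆, e⁆ = a := by
    rw [bracket_neg, neg_bracket, neg_bracket, neg_bracket, neg_neg, bracket_bracket_eq_self hij ha]
  have hw : ⁅⁅-a, -b⁆, e⁆ ∈ peirce e j i := halt.bracket_diag_mem he.2.1 hij.symm
    (halt.bracket_mem_swap hij (neg_mem ha) (neg_mem hb)) hee
  rw [add_bracket, bracket_add, bracket_add, add_bracket, add_bracket, add_bracket, h₁, h₂, h₃,
    hD.map_zero, zero_add, zero_add, ← add_assoc, ← add_assoc,
    map_add_of_defect_eq_zero
      (hD.defect_offdiag_eq_zero hprime halt he hij (add_mem hb ha) hw), add_left_inj] at h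
  rw [defect_comm, defect, h]
  abel

theorem IsLieTripleDerivable.bracket_defect_diag (hD : IsLieTripleDerivable D)
    (hprime : IsPrimeRing R) (halt : IsAlternative R) (he : IsNontrivialIdempotent e)
    {a b : R} (ha : Commute e a) (hb : Commute e b) (x : R) : ⁅x, defect D a b⁆ = 0 := by
  have hTF : true ≠ false := by decide
  refine hD.bracket_defect_eq_zero hprime halt he hTF (hD.commute_defect halt he.2.1 a hb)
    (fun y hy => ?_) x
  rw [hD.defect_same_offdiag_eq_zero hprime halt he hTF (halt.bracket_diag_mem he.2.1 hTF hy ha)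
    (halt.bracket_diag_mem he.2.1 hTF hy hb)]
  exact Commute.zero_right e

theorem IsLieTripleDerivable.bracket_defect_add_offdiag (hD : IsLieTripleDerivable D)
    (hprime : IsPrimeRing R) (halt : IsAlternative R) (he : IsNontrivialIdempotent e)
    {i j : Bool} (hij : i ≠ j) {a b c : R} (ha : Commute e a) (hb : b ∈ peirce e i j)
    (hc : c ∈ peirce e j i) (x : R) : ⁅x, defect D (a + b) c⁆ = 0 := by
  refine hD.bracket_defect_eq_zero hprime halt he hij ?_ (fun y hy => ?_) x
  · apply halt.commute_of_bracket_bracket he.2.1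
    rw [hD.bracket_bracket_defect, add_bracket, add_bracket, bracket_bracket_eq_zero ha,
      bracket_bracket_eq_self hij hb, bracket_bracket_eq_self hij.symm hc, zero_add,
      hD.defect_offdiag_eq_zero hprime halt he hij hb hc]
  · exact hD.commute_defect halt he.2.1 _ (halt.commute_bracket hy hc)

end AltRing

theorem mainTheorem3 {R : Type*} [NonUnitalNonAssocRing R]
    (halt : AltRing.IsAlternative R) (htf : AltRing.IsTorsionFreeBy 3 R)
    (hprime : AltRing.IsPrimeRing R)
    (e : R) (he : AltRing.IsNontrivialIdempotent e)
    (D : R → R) (hD : AltRing.IsLieTripleDerivable D) :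
    AltRing.IsAlmostAdditive D := by
  open AltRing in
  intro r s
  refine ⟨defect D r s, halt.mem_center htf ?_, by rw [defect]; abel⟩
  have hTF : true ≠ false := by decide
  have hdec (r : R) : ∃ a, Commute e a ∧ ∃ b ∈ peirce e true false, ∃ c ∈ peirce e false true,
      r = a + b + c := by
    obtain ⟨a, ha, b, hb, c, hc, d, hd, rfl⟩ := halt.exists_peirce he.2.1 hTF r
    exact ⟨a + d, (commute_of_mem_peirce ha).add_right (commute_of_mem_peirce hd), b, hb, c, hc,
      by abel⟩
  obtain ⟨a, ha, b, hb, c, hc, rfl⟩ := hdec r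
  obtain ⟨a', ha', b', hb', c', hc', rfl⟩ := hdec s
  -- The defect is the one on the diagonal part, up to the defects of the two Peirce decompositions
  -- and that of their sum.
  have key : defect D (a + b + c) (a' + b' + c') =
      (defect D (a + a' + (b + b')) (c + c') + defect D (a + a') (b + b') + defect D a a')
      - (defect D (a + b) c + defect D a b) - (defect D (a' + b') c' + defect D a' b') := by
    have hb₂ := map_add_of_defect_eq_zero
      (hD.defect_same_offdiag_eq_zero hprime halt he hTF hb hb')
    have hc₂ := map_add_of_defect_eq_zero
      (hD.defect_same_offdiag_eq_zero hprime halt he hTF.symm hc hc')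
    have h : a + b + c + (a' + b' + c') = a + a' + (b + b') + (c + c') := by abel
    simp only [defect, h, hb₂, hc₂]
    abel
  intro x
  have h₁ := hD.bracket_defect_add_offdiag hprime halt he hTF (ha.add_right ha') (add_mem hb hb')
    (add_mem hc hc') x
  have h₂ := hD.bracket_defect_diag_offdiag hprime halt he hTF (ha.add_right ha')
    (add_mem hb hb') x
  have h₃ := hD.bracket_defect_diag hprime halt he ha ha' x
  have h₄ := hD.bracket_defect_add_offdiag hprime halt he hTF ha hb hc x
  have h₅ := hD.bracket_defect_diag_offdiag hprime halt he hTF ha hb x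
  have h₆ := hD.bracket_defect_add_offdiag hprime halt he hTF ha' hb' hc' x
  have h₇ := hD.bracket_defect_diag_offdiag hprime halt he hTF ha' hb' x
  rw [key]
  simp [sub_eq_add_neg, bracket_add, bracket_neg, h₁, h₂, h₃, h₄, h₅, h₆, h₇]
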